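/- Let $\mathcal H$ be a separable complex Hilbert space, let $\rho$ be a state on $\mathcal H$ (a positive trace-class operator with $\operatorname{Tr}[\rho]=1$), let $\sigma$ be a positive semi-definite trace-class operator on $\mathcal H$, and let $\varepsilon\in(0,1)$. A substate is a positive semi-definite trace-class operator $\tau$ with $\operatorname{Tr}[\tau]\le 1$. For substates $\tau,\omega$ the sine distance is $$P(\tau,\omega):=\sqrt{1-F\big(\tau\oplus(1-\operatorname{Tr}[\tau]),\,\omega\oplus(1-\operatorname{Tr}[\omega])\big)},\qquad F(\alpha,\beta):=\big\|\sqrt{\alpha}\sqrt{\beta}\big\|_1^2,$$ where the direct sums act on $\mathcal H\oplus\mathbb C$. Define the smooth max-relative entropy and its dual by $$D_{\max}^{\varepsilon}(\rho\Vert\sigma):=\log_2\ \inf_{\tilde\rho\,:\,P(\tilde\rho,\rho)\le\varepsilon}\ \inf\{\lambda\ge 0:\tilde\rho\le\lambda\sigma\},$$ $$\widehat D_{\max}^{\varepsilon}(\rho\Vert\sigma):=\log_2\ \sup_{M}\ \inf_{\tilde\rho\,:\,P(\tilde\rho,\rho)\le\varepsilon}\operatorname{Tr}[M\tilde\rho],$$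 where $\tilde\rho$ ranges over the substates on $\mathcal H$ and $M$ over the compact positive semi-definite operators on $\mathcal H$ with $\operatorname{Tr}[M\sigma]\le 1$ (with values in $[-\infty,\infty]$, $\inf\emptyset=\infty$, $\log_2 0=-\infty$ and $\log_2\infty=\infty$). If $D_{\max}^{\varepsilon}(\rho\Vert\sigma)<\infty$, then $$D_{\max}^{\varepsilon}(\rho\Vert\sigma)=\widehat D_{\max}^{\varepsilon}(\rho\Vert\sigma).$$ -/

import Mathlib

open scoped NNReal ENNReal InnerProductSpace

noncomputable section

namespace QInfo

section Trace

/-- Parseval's identity. -/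
theorem parseval {α E : Type*} [NormedAddCommGroup E] [InnerProductSpace ℂ E]
    (d : HilbertBasis α ℂ E) (x : E) :
    ENNReal.ofReal (‖x‖ ^ 2) = ∑' a, ENNReal.ofReal (‖⟪d a, x⟫_ℂ‖ ^ 2) := by
  have h := d.hasSum_inner_mul_inner x x
  have h2 : HasSum (fun a => ‖⟪d a, x⟫_ℂ‖ ^ 2) (‖x‖ ^ 2) := by
    have h3 := Complex.hasSum_re h
    rw [inner_self_eq_norm_sq_to_K] at h3
    convert h3 using 1
    · funext a
      rw [← inner_conj_symm x (d a), ← Complex.normSq_eq_conj_mul_self, Complex.normSq_eq_norm_sq,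
        Complex.ofReal_re]
    · norm_cast
  rw [← h2.tsum_eq, ENNReal.ofReal_tsum_of_nonneg (fun a => by positivity) h2.summable]

variable {K : Type*} [NormedAddCommGroup K] [InnerProductSpace ℂ K] [CompleteSpace K]

/-- The index set of a fixed orthonormal (Hilbert) basis of `K`. -/
def basisIndex (K : Type*) [NormedAddCommGroup K] [InnerProductSpace ℂ K] [CompleteSpace K] :
    Set K :=
  (exists_hilbertBasis ℂ K).choose

/-- A fixed orthonormal (Hilbert) basis of `K`, used to write down traces. -/
def basis (K : Type*) [NormedAddCommGroup K] [InnerProductSpace ℂ K] [CompleteSpace K] :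
    HilbertBasis (basisIndex K) ℂ K :=
  (exists_hilbertBasis ℂ K).choose_spec.choose

/-- The trace `Tr[T] = ∑ᵢ ⟨eᵢ, T eᵢ⟩`. For a trace-class operator the series converges absolutely
and its value does not depend on the orthonormal basis. -/
def trace (T : K →L[ℂ] K) : ℂ :=
  ∑' i, ⟪basis K i, T (basis K i)⟫_ℂ

/-- The trace norm `‖T‖₁ = Tr |T|`, with `|T| = √(T* T)`, as an extended non-negative real. -/
def traceNorm (T : K →L[ℂ] K) : ℝ≥0∞ :=
  ∑' i, ENNReal.ofReal (⟪basis K i, CFC.abs T (basis K i)⟫_ℂ).re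

/-- Trace-class operators. -/
def IsTraceClass (T : K →L[ℂ] K) : Prop :=
  traceNorm T < ⊤

/-- The series of diagonal entries of a positive operator has the same sum in any two orthonormal
bases, so that the trace norm does not depend on the basis. -/
theorem tsum_diag_eq {ι κ : Type*} (b : HilbertBasis ι ℂ K) (c : HilbertBasis κ ℂ K)
    {T : K →L[ℂ] K} (hT : 0 ≤ T) :
    ∑' i, ENNReal.ofReal (⟪b i, T (b i)⟫_ℂ).re = ∑' j, ENNReal.ofReal (⟪c j, T (c j)⟫_ℂ).re := by
  set S := CFC.sqrt T with hS
  have hS0 : 0 ≤ S := CFC.sqrt_nonneg T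
  have hsa : IsSelfAdjoint S := IsSelfAdjoint.of_nonneg hS0
  have hsym : ∀ x y, ⟪S x, y⟫_ℂ = ⟪x, S y⟫_ℂ := fun x y => hsa.isSymmetric x y
  have hmul : S * S = T := CFC.sqrt_mul_sqrt_self T hT
  have key : ∀ x, (⟪x, T x⟫_ℂ).re = ‖S x‖ ^ 2 := by
    intro x
    rw [← hmul, mul_apply_eq_comp, ← hsym, inner_self_eq_norm_sq_to_K]
    norm_cast
  calc ∑' i, ENNReal.ofReal (⟪b i, T (b i)⟫_ℂ).re
      = ∑' i, ∑' j, ENNReal.ofReal (‖⟪c j, S (b i)⟫_ℂ‖ ^ 2) := by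
        congr 1; funext i; rw [key, parseval c]
    _ = ∑' j, ∑' i, ENNReal.ofReal (‖⟪c j, S (b i)⟫_ℂ‖ ^ 2) := ENNReal.tsum_comm
    _ = ∑' j, ENNReal.ofReal (⟪c j, T (c j)⟫_ℂ).re := by
        congr 1; funext j; rw [key, parseval b]
        congr 1; funext i
        rw [← hsym, norm_inner_symm]

/-- The fidelity `F(τ, ω) = ‖√τ √ω‖₁²` of positive trace-class operators. -/
def fidelity (τ ω : K →L[ℂ] K) : ℝ :=
  (traceNorm (CFC.sqrt τ * CFC.sqrt ω)).toReal ^ 2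

end Trace

variable {H : Type*} [NormedAddCommGroup H] [InnerProductSpace ℂ H] [CompleteSpace H]

/-- Density operators: positive trace-class operators of trace one. -/
def IsState (ρ : H →L[ℂ] H) : Prop :=
  0 ≤ ρ ∧ IsTraceClass ρ ∧ trace ρ = 1

/-- Subnormalized states: positive trace-class operators of trace at most one. -/
def IsSubstate (τ : H →L[ℂ] H) : Prop :=
  0 ≤ τ ∧ IsTraceClass τ ∧ (trace τ).re ≤ 1

/-- The operator `τ ⊕ c` on the Hilbert space `H ⊕ ℂ`. -/
def directSum (τ : H →L[ℂ] H) (c : ℂ) : WithLp 2 (H × ℂ) →L[ℂ] WithLp 2 (H × ℂ) :=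
  ((WithLp.prodContinuousLinearEquiv 2 ℂ H ℂ).symm : H × ℂ →L[ℂ] WithLp 2 (H × ℂ)) ∘L
    (τ.prodMap (c • ContinuousLinearMap.id ℂ ℂ)) ∘L
      (WithLp.prodContinuousLinearEquiv 2 ℂ H ℂ : WithLp 2 (H × ℂ) →L[ℂ] H × ℂ)

/-- The sine distance of substates,
`P(τ, ω) = √(1 - F(τ ⊕ (1 - Tr[τ]), ω ⊕ (1 - Tr[ω])))`. -/
def sineDistance (τ ω : H →L[ℂ] H) : ℝ :=
  Real.sqrt (1 - fidelity (directSum τ (1 - trace τ)) (directSum ω (1 - trace ω)))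

/-- The binary logarithm on `[0, ∞]`, with `log₂ 0 = -∞` and `log₂ ∞ = ∞`. -/
def log₂ (x : ℝ≥0∞) : EReal :=
  ENNReal.log x / ((Real.log 2 : ℝ) : EReal)

/-- The smooth max-relative entropy
`log₂ inf {lam : lam ≥ 0, τ a substate, P(τ, ρ) ≤ ε, τ ≤ lam σ}`;
the infimum of the empty set is `∞`. -/
def smoothDmax (ε : ℝ) (ρ σ : H →L[ℂ] H) : EReal :=
  log₂ (⨅ (τ : H →L[ℂ] H) (_ : IsSubstate τ ∧ sineDistance τ ρ ≤ ε),
    ⨅ (lam : ℝ≥0) (_ : τ ≤ ((lam : ℝ) : ℂ) • σ), (lam : ℝ≥0∞))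

/-- The dual smooth max-relative entropy
`log₂ sup {inf {Tr[M τ] : τ a substate, P(τ, ρ) ≤ ε} : M ≥ 0 compact, Tr[M σ] ≤ 1}`.
For `M, τ ≥ 0` the trace `Tr[M τ]` is a non-negative real number. -/
def dualSmoothDmax (ε : ℝ) (ρ σ : H →L[ℂ] H) : EReal :=
  log₂ (⨆ (M : H →L[ℂ] H) (_ : 0 ≤ M ∧ IsCompactOperator M ∧ (trace (M ∘L σ)).re ≤ 1),
    ⨅ (τ : H →L[ℂ] H) (_ : IsSubstate τ ∧ sineDistance τ ρ ≤ ε),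
      ENNReal.ofReal (trace (M ∘L τ)).re)

end QInfo

end

/-! Weak duality is monotonicity: if `τ ≤ λσ`, then `Tr[Mτ] ≤ λ Tr[Mσ] ≤ λ`.

For the converse the smoothing ball is lifted to Hilbert–Schmidt factors, in the spirit of Uhlmann's
theorem. Call `A` admissible if `‖A‖₂ ≤ 1` and `Re⟨A, √ρ⟩ ≥ √(1 - ε²)`. For admissible `A` the
operator `A A*` lies in the ball (`sineDistance_comp_adjoint_le`), and every `τ` in the ball
dominates some such `A A*` (`exists_hilbertSchmidt_of_sineDistance_le`). The admissible `A` form a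
bounded closed convex subset of a Hilbert space, and `A A* ≤ λσ` amounts to countably many
continuous convex inequalities `‖A* vₖ‖² ≤ λ⟨vₖ, σ vₖ⟩` along a dense sequence.

If `λ` exceeds the dual value, testing the dual with normalized finite-rank, hence compact,
operators `∑ wₖ |vₖ⟩⟨vₖ|` shows that each finite non-negative combination of the inequalities can be
nearly satisfied. Hahn–Banach in finite dimension upgrades this to near-solutions of finite
subsystems, and weak compactness, in the form of nested bounded closed convex sets, yields an exact
solution of the whole system. So `λ` is also primal feasible, and no gap can exist. -/

open scoped NNReal ENNReal InnerProductSpace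

set_option linter.unusedSectionVars false

noncomputable section

namespace QInfo

/-! ### Hilbert–Schmidt norm and pairing, with their invariance under adjoints. -/

section HilbertSchmidt

variable {E F G : Type*} [NormedAddCommGroup E] [InnerProductSpace ℂ E] [CompleteSpace E]
  [NormedAddCommGroup F] [InnerProductSpace ℂ F] [CompleteSpace F]
  [NormedAddCommGroup G] [InnerProductSpace ℂ G] [CompleteSpace G]

open ContinuousLinearMap (adjoint)

/-- The square of the Hilbert–Schmidt norm. -/
def hsSq (T : E →L[ℂ] F) : ℝ≥0∞ :=
  ∑' i, ENNReal.ofReal (‖T (basis E i)‖ ^ 2)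

/-- The Hilbert–Schmidt inner product. -/
def hsInner (P Q : E →L[ℂ] F) : ℂ :=
  ∑' i, ⟪P (basis E i), Q (basis E i)⟫_ℂ

theorem hsSq_eq_tsum_tsum (T : E →L[ℂ] F) :
    hsSq T = ∑' i, ∑' j, ENNReal.ofReal (‖⟪basis F j, T (basis E i)⟫_ℂ‖ ^ 2) := by
  unfold hsSq
  congr 1; funext i; rw [parseval (basis F)]

theorem hsSq_adjoint (T : E →L[ℂ] F) : hsSq (adjoint T) = hsSq T := by
  rw [hsSq_eq_tsum_tsum, hsSq_eq_tsum_tsum, ENNReal.tsum_comm]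
  congr 1; funext i; congr 1; funext j
  rw [ContinuousLinearMap.adjoint_inner_right, norm_inner_symm]

theorem hsSq_comp_le (V : F →L[ℂ] G) (T : E →L[ℂ] F) :
    hsSq (V ∘L T) ≤ ENNReal.ofReal (‖V‖ ^ 2) * hsSq T := by
  unfold hsSq
  rw [← ENNReal.tsum_mul_left]
  refine ENNReal.tsum_le_tsum fun i => ?_
  rw [← ENNReal.ofReal_mul (by positivity), ← mul_pow]
  apply ENNReal.ofReal_le_ofReal
  gcongr
  exact V.le_opNorm _

theorem hsSq_comp_le' (T : F →L[ℂ] G) (V : E →L[ℂ] F) :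
    hsSq (T ∘L V) ≤ ENNReal.ofReal (‖V‖ ^ 2) * hsSq T := by
  rw [← hsSq_adjoint, ContinuousLinearMap.adjoint_comp]
  refine (hsSq_comp_le _ _).trans ?_
  rw [hsSq_adjoint, LinearIsometryEquiv.norm_map]

theorem hsSq_comp_ne_top (V : F →L[ℂ] G) {T : E →L[ℂ] F} (hT : hsSq T ≠ ⊤) :
    hsSq (V ∘L T) ≠ ⊤ :=
  ne_top_of_le_ne_top (ENNReal.mul_ne_top ENNReal.ofReal_ne_top hT) (hsSq_comp_le V T)

theorem hsSq_comp_ne_top' {T : F →L[ℂ] G} (hT : hsSq T ≠ ⊤) (V : E →L[ℂ] F) :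
    hsSq (T ∘L V) ≠ ⊤ :=
  ne_top_of_le_ne_top (ENNReal.mul_ne_top ENNReal.ofReal_ne_top hT) (hsSq_comp_le' T V)

theorem hsSq_comp_le_of_norm_le_one (T : F →L[ℂ] G) {V : E →L[ℂ] F} (hV : ‖V‖ ≤ 1) :
    hsSq (T ∘L V) ≤ hsSq T := by
  refine (hsSq_comp_le' T V).trans (mul_le_of_le_one_left' ?_)
  rw [← ENNReal.ofReal_one]
  exact ENNReal.ofReal_le_ofReal (pow_le_one₀ (norm_nonneg _) hV)

theorem summable_norm_sq {T : E →L[ℂ] F} (hT : hsSq T ≠ ⊤) :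
    Summable fun i => ‖T (basis E i)‖ ^ 2 := by
  have h := ENNReal.summable_toReal hT
  refine h.congr fun i => ?_
  rw [ENNReal.toReal_ofReal (by positivity)]

theorem hsSq_toReal (T : E →L[ℂ] F) :
    (hsSq T).toReal = ∑' i, ‖T (basis E i)‖ ^ 2 := by
  unfold hsSq
  rw [ENNReal.tsum_toReal_eq (fun _ => ENNReal.ofReal_ne_top)]
  congr 1; funext i
  rw [ENNReal.toReal_ofReal (by positivity)]

theorem norm_inner_le_half (x y : F) : ‖⟪x, y⟫_ℂ‖ ≤ (‖x‖ ^ 2 + ‖y‖ ^ 2) / 2 := by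
  have := norm_inner_le_norm (𝕜 := ℂ) x y
  nlinarith [sq_nonneg (‖x‖ - ‖y‖)]

theorem summable_hsInner_norm {P Q : E →L[ℂ] F} (hP : hsSq P ≠ ⊤) (hQ : hsSq Q ≠ ⊤) :
    Summable fun i => ‖⟪P (basis E i), Q (basis E i)⟫_ℂ‖ :=
  Summable.of_nonneg_of_le (fun _ => norm_nonneg _) (fun _ => norm_inner_le_half _ _)
    (((summable_norm_sq hP).add (summable_norm_sq hQ)).div_const 2)

/-- The arithmetic-mean bound replaces Cauchy–Schwarz; it loses nothing where it is used, since
there both norms have the same upper bound. -/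
theorem norm_hsInner_le {P Q : E →L[ℂ] F} (hP : hsSq P ≠ ⊤) (hQ : hsSq Q ≠ ⊤) :
    ‖hsInner P Q‖ ≤ ((hsSq P).toReal + (hsSq Q).toReal) / 2 := by
  have h1 := summable_hsInner_norm hP hQ
  have h2 := ((summable_norm_sq hP).add (summable_norm_sq hQ)).div_const 2
  calc ‖hsInner P Q‖ ≤ ∑' i, ‖⟪P (basis E i), Q (basis E i)⟫_ℂ‖ := norm_tsum_le_tsum_norm h1
    _ ≤ ∑' i, (‖P (basis E i)‖ ^ 2 + ‖Q (basis E i)‖ ^ 2) / 2 :=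
        h1.tsum_le_tsum (fun _ => norm_inner_le_half _ _) h2
    _ = _ := by
        rw [hsSq_toReal, hsSq_toReal, tsum_div_const,
          (summable_norm_sq hP).tsum_add (summable_norm_sq hQ)]

theorem summable_norm_inner_sq {T : E →L[ℂ] F} (hT : hsSq T ≠ ⊤) :
    Summable fun p : basisIndex E × basisIndex F =>
      ‖⟪basis F p.2, T (basis E p.1)⟫_ℂ‖ ^ 2 := by
  rw [hsSq_eq_tsum_tsum, ← ENNReal.tsum_prod] at hT
  have h := ENNReal.summable_toReal hT
  refine h.congr fun i => ?_
  rw [ENNReal.toReal_ofReal (by positivity)]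

/-- Fubini for the double series of matrix entries, which converges absolutely because both factors
are Hilbert–Schmidt. -/
theorem hsInner_adjoint {P Q : E →L[ℂ] F} (hP : hsSq P ≠ ⊤) (hQ : hsSq Q ≠ ⊤) :
    hsInner P Q = hsInner (adjoint Q) (adjoint P) := by
  set f : basisIndex E → basisIndex F → ℂ := fun i j =>
    ⟪P (basis E i), basis F j⟫_ℂ * ⟪basis F j, Q (basis E i)⟫_ℂ with hf
  have hs : Summable (Function.uncurry f) := by
    refine Summable.of_norm_bounded (((summable_norm_inner_sq hP).add
      (summable_norm_inner_sq hQ)).div_const 2) fun p => ?_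
    simp only [Function.uncurry, hf, norm_mul]
    rw [norm_inner_symm]
    nlinarith [sq_nonneg (‖⟪basis F p.2, P (basis E p.1)⟫_ℂ‖ - ‖⟪basis F p.2, Q (basis E p.1)⟫_ℂ‖)]
  calc hsInner P Q = ∑' i, ∑' j, f i j := by
        unfold hsInner
        congr 1; funext i
        exact ((basis F).tsum_inner_mul_inner _ _).symm
    _ = ∑' j, ∑' i, f i j := hs.tsum_comm.symm
    _ = _ := by
        unfold hsInner
        congr 1; funext j
        rw [← (basis E).tsum_inner_mul_inner]
        congr 1; funext i
        simp only [hf]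
        rw [ContinuousLinearMap.adjoint_inner_left, ContinuousLinearMap.adjoint_inner_right,
          mul_comm]

theorem hsInner_comp_left (V : F →L[ℂ] G) (P : E →L[ℂ] F) (Q : E →L[ℂ] G) :
    hsInner (V ∘L P) Q = hsInner P (adjoint V ∘L Q) := by
  unfold hsInner
  congr 1; funext i
  simp [ContinuousLinearMap.adjoint_inner_right]

/-- Cyclicity of the trace: after taking adjoints, a right factor becomes a left factor, which moves
across termwise. -/
theorem hsInner_comp_right {P : F →L[ℂ] G} {Q : E →L[ℂ] G} (V : E →L[ℂ] F)
    (hP : hsSq P ≠ ⊤) (hQ : hsSq Q ≠ ⊤) :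
    hsInner (P ∘L V) Q = hsInner P (Q ∘L adjoint V) := by
  rw [hsInner_adjoint (hsSq_comp_ne_top' hP V) hQ,
    hsInner_adjoint hP (hsSq_comp_ne_top' hQ _), ContinuousLinearMap.adjoint_comp,
    ContinuousLinearMap.adjoint_comp, ContinuousLinearMap.adjoint_adjoint, hsInner_comp_left]

theorem hsInner_self {P : E →L[ℂ] F} :
    hsInner P P = ((hsSq P).toReal : ℂ) := by
  rw [hsSq_toReal, Complex.ofReal_tsum]
  unfold hsInner
  congr 1; funext i
  rw [inner_self_eq_norm_sq_to_K]
  norm_cast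

end HilbertSchmidt

/-! ### Factorization through a contraction. -/

section Contraction

variable {E F G : Type*} [NormedAddCommGroup E] [InnerProductSpace ℂ E] [CompleteSpace E]
  [NormedAddCommGroup F] [InnerProductSpace ℂ F] [CompleteSpace F]
  [NormedAddCommGroup G] [InnerProductSpace ℂ G] [CompleteSpace G]

/-- Douglas factorization. -/
theorem exists_contraction_comp_eq (T : E →L[ℂ] G) (S : E →L[ℂ] F) (h : ∀ x, ‖T x‖ ≤ ‖S x‖) :
    ∃ V : F →L[ℂ] G, ‖V‖ ≤ 1 ∧ V ∘L S = T := by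
  set U : Submodule ℂ F := S.range.topologicalClosure with hU
  have hmem : ∀ x, S x ∈ U := fun x => Submodule.le_topologicalClosure _ ⟨x, rfl⟩
  set S' : E →ₗ[ℂ] U := (S : E →ₗ[ℂ] F).codRestrict U hmem with hS'
  have hd : DenseRange S' := by
    intro y
    rw [Metric.mem_closure_iff]
    intro δ hδ
    have hy : (y : F) ∈ closure (S.range : Set F) := y.2
    obtain ⟨_, ⟨x, rfl⟩, hx⟩ := Metric.mem_closure_iff.1 hy δ hδ
    exact ⟨S' x, ⟨x, rfl⟩, hx⟩
  have hn : ∀ x, ‖(T : E →ₗ[ℂ] G) x‖ ≤ 1 * ‖S' x‖ := fun x => by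
    rw [one_mul]; exact h x
  have : CompleteSpace U := (Submodule.isClosed_topologicalClosure _).completeSpace_coe
  set V' := (T : E →ₗ[ℂ] G).extendOfNorm S'
  -- `S x ↦ T x` is well defined and contractive on the range of `S`; it is extended to the closure
  -- by continuity and by zero to the orthogonal complement.
  refine ⟨V' ∘L U.orthogonalProjectionOnto, ?_, ?_⟩
  · refine (ContinuousLinearMap.opNorm_comp_le _ _).trans ?_
    have h1 : ‖V'‖ ≤ 1 := LinearMap.opNorm_extendOfNorm_le hd zero_le_one hn
    have h2 := U.orthogonalProjectionOnto_norm_le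
    calc _ ≤ (1 : ℝ) * 1 := by gcongr
      _ = 1 := one_mul 1
  · ext x
    have h3 : U.orthogonalProjectionOnto (S x) = S' x :=
      Submodule.orthogonalProjectionOnto_mem_subspace_eq_self ⟨S x, hmem x⟩
    simp only [ContinuousLinearMap.comp_apply, h3]
    exact LinearMap.extendOfNorm_eq hd ⟨1, hn⟩ x

end Contraction

/-! ### Systems of convex inequalities: separation and weak compactness. -/

section Minimax

open Set Filter Topology

/-- A system of finitely many convex inequalities, each non-negative combination of which can be
nearly satisfied, can itself be nearly satisfied. -/
theorem exists_forall_lt_of_forall_sum_lt {E ι : Type*} [AddCommGroup E] [Module ℝ E] [Fintype ι]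
    {C : Set E} (hC : C.Nonempty) (hcv : Convex ℝ C) {q : ι → E → ℝ} (hq : ∀ i, ConvexOn ℝ C (q i))
    (h : ∀ c : ι → ℝ, (∀ i, 0 ≤ c i) → ∀ δ > 0, ∃ a ∈ C, ∑ i, c i * q i a < δ)
    {δ : ℝ} (hδ : 0 < δ) : ∃ a ∈ C, ∀ i, q i a < δ := by
  classical
  by_contra hcon
  -- The strict upper bounds of the vectors `(q i a)ᵢ`: an open convex set which, if the conclusion
  -- fails, misses the constant vector `δ` and can be separated from it.
  set s : Set (ι → ℝ) := {y | ∃ a ∈ C, ∀ i, q i a < y i} with hs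
  have hsc : Convex ℝ s := by
    rintro y ⟨a, ha, hay⟩ z ⟨b, hb, hbz⟩ u v hu hv huv
    refine ⟨u • a + v • b, hcv ha hb hu hv huv, fun i => ?_⟩
    refine ((hq i).2 ha hb hu hv huv).trans_lt ?_
    simp only [Pi.add_apply, Pi.smul_apply, smul_eq_mul]
    rcases hu.eq_or_lt with rfl | hu'
    · have : v = 1 := by linarith
      subst this; simpa using hbz i
    · nlinarith [mul_lt_mul_of_pos_left (hay i) hu', mul_le_mul_of_nonneg_left (hbz i).le hv]
  have hso : IsOpen s := by
    have : s = ⋃ a ∈ C, ⋂ i, {y : ι → ℝ | q i a < y i} := by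
      ext y; simp [hs]
    rw [this]
    exact isOpen_biUnion fun a _ => isOpen_iInter_of_finite fun i =>
      isOpen_lt continuous_const (continuous_apply i)
  have hns : (fun _ => δ : ι → ℝ) ∉ s := fun ⟨a, ha, h1⟩ => hcon ⟨a, ha, h1⟩
  obtain ⟨f, hf⟩ := geometric_hahn_banach_point_open hsc hso hns
  set c : ι → ℝ := fun i => f (Pi.single i 1) with hc
  have hfc : ∀ y, f y = ∑ i, c i * y i := fun y => by
    conv_lhs => rw [pi_eq_sum_univ' y]
    simp [hc, mul_comm]
  obtain ⟨a₀, ha₀⟩ := hC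
  have hcnn : ∀ i, 0 ≤ c i := by
    intro i
    by_contra hneg
    push Not at hneg
    set y : ι → ℝ := fun j => q j a₀ + 1
    -- `s` is stable under increasing a coordinate, so a negative `c i` would make `f` unbounded
    -- below on `s`.
    obtain ⟨t, ht0, ht⟩ : ∃ t : ℝ, 0 ≤ t ∧ f y + t * c i ≤ f (fun _ => δ) := by
      refine ⟨max 0 ((f (fun _ => δ) - f y) / c i), le_max_left _ _, ?_⟩
      have := mul_le_mul_of_nonpos_right (le_max_right 0 ((f (fun _ => δ) - f y) / c i)) hneg.le
      rw [div_mul_cancel₀ _ hneg.ne] at this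
      linarith
    have hmem : y + t • Pi.single i 1 ∈ s := by
      refine ⟨a₀, ha₀, fun j => ?_⟩
      have : 0 ≤ (Pi.single i 1 : ι → ℝ) j := by
        by_cases hj : j = i
        · subst hj; simp
        · simp [hj]
      simp only [Pi.add_apply, Pi.smul_apply, smul_eq_mul, y]
      nlinarith [mul_nonneg ht0 this]
    have := hf _ hmem
    rw [map_add, map_smul, smul_eq_mul] at this
    linarith
  have hsum : ∀ a ∈ C, δ * ∑ i, c i ≤ ∑ i, c i * q i a := by
    intro a ha
    refine le_of_forall_pos_lt_add fun η hη => ?_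
    obtain ⟨κ, hκ, hκη⟩ : ∃ κ > 0, κ * ∑ i, c i < η := by
      have h0 : 0 ≤ ∑ i, c i := Finset.sum_nonneg fun i _ => hcnn i
      refine ⟨η / (∑ i, c i + 1), by positivity, ?_⟩
      rw [div_mul_eq_mul_div, div_lt_iff₀ (by positivity)]
      nlinarith
    have := hf (fun i => q i a + κ) ⟨a, ha, fun i => by linarith⟩
    simp only [hfc, mul_add, Finset.sum_add_distrib, ← Finset.sum_mul] at this
    linarith
  have hpos : 0 < ∑ i, c i := by
    refine (Finset.sum_nonneg fun i _ => hcnn i).lt_of_ne' fun h0 => ?_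
    have h1 : ∀ i, c i = 0 := fun i =>
      (Finset.sum_eq_zero_iff_of_nonneg fun i _ => hcnn i).1 h0 i (Finset.mem_univ i)
    have := hf (fun i => q i a₀ + 1) ⟨a₀, ha₀, fun i => by linarith⟩
    simp [hfc, h1] at this
  -- The tolerance `δ * ∑ c i` is exactly the lower bound of `hsum`, hence the contradiction.
  obtain ⟨a, ha, hlt⟩ := h c hcnn (δ * ∑ i, c i) (by positivity)
  exact absurd (hsum a ha) (not_le.2 hlt)

/-- In a Hilbert space, a decreasing sequence of nonempty bounded closed convex sets has nonempty
intersection. -/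
theorem nonempty_iInter_of_convex {E : Type*} [NormedAddCommGroup E] [InnerProductSpace ℝ E]
    [CompleteSpace E] {C : ℕ → Set E} (hanti : Antitone C) (hne : ∀ n, (C n).Nonempty)
    (hcl : ∀ n, IsClosed (C n)) (hcv : ∀ n, Convex ℝ (C n)) (hb : Bornology.IsBounded (C 0)) :
    (⋂ n, C n).Nonempty := by
  -- The points of minimal norm, with the obtuse-angle inequality. Their norms increase and stay
  -- bounded, so this inequality makes them Cauchy.
  have hmin : ∀ n, ∃ v ∈ C n, ∀ w ∈ C n, ‖v‖ ^ 2 + ‖v - w‖ ^ 2 ≤ ‖w‖ ^ 2 := by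
    intro n
    obtain ⟨v, hv, hvn⟩ := exists_norm_eq_iInf_of_complete_convex (hne n)
      (hcl n).isComplete (hcv n) 0
    refine ⟨v, hv, fun w hw => ?_⟩
    have := (norm_eq_iInf_iff_real_inner_le_zero (hcv n) hv).1 hvn w hw
    rw [zero_sub, inner_neg_left, inner_sub_right, real_inner_self_eq_norm_sq] at this
    rw [norm_sub_sq_real]
    linarith
  choose v hv hvmin using hmin
  obtain ⟨R, hR⟩ := hb.exists_norm_le
  have hmono : Monotone fun n => ‖v n‖ ^ 2 := fun m n hmn => by
    have := hvmin m (v n) (hanti hmn (hv n))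
    dsimp only
    nlinarith [sq_nonneg ‖v m - v n‖]
  have hbdd : BddAbove (range fun n => ‖v n‖ ^ 2) := by
    refine ⟨R ^ 2, ?_⟩
    rintro _ ⟨n, rfl⟩
    have := hR _ (hanti (Nat.zero_le n) (hv n))
    dsimp only
    gcongr
  have hconv := (tendsto_atTop_ciSup hmono hbdd).cauchySeq
  have hcau : CauchySeq v := by
    rw [Metric.cauchySeq_iff'] at hconv ⊢
    intro δ hδ
    obtain ⟨N, hN⟩ := hconv (δ ^ 2) (by positivity)
    refine ⟨N, fun n hn => ?_⟩
    have h1 := hN n hn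
    have h2 := hvmin N (v n) (hanti hn (hv n))
    rw [Real.dist_eq] at h1
    have h3 := (le_abs_self _).trans_lt h1
    rw [dist_comm, dist_eq_norm]
    exact lt_of_pow_lt_pow_left₀ 2 hδ.le (by linarith)
  obtain ⟨a, ha⟩ := cauchySeq_tendsto_of_complete hcau
  refine ⟨a, mem_iInter.2 fun n => (hcl n).mem_of_tendsto ha ?_⟩
  filter_upwards [eventually_ge_atTop n] with m hm using hanti hm (hv m)

/-- A sequence of convex inequalities on a bounded closed convex set in a Hilbert space, each
finite non-negative combination of which can be nearly satisfied, has a common solution. -/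
theorem exists_forall_le_zero_of_forall_sum_lt {E : Type*} [NormedAddCommGroup E]
    [InnerProductSpace ℝ E] [CompleteSpace E] {C : Set E} (hcl : IsClosed C) (hcv : Convex ℝ C)
    (hb : Bornology.IsBounded C) {q : ℕ → E → ℝ} (hq : ∀ k, ConvexOn ℝ univ (q k))
    (hqc : ∀ k, Continuous (q k))
    (h : ∀ (n : ℕ) (c : Fin n → ℝ), (∀ k, 0 ≤ c k) → ∀ δ > 0,
      ∃ a ∈ C, ∑ k, c k * q k a < δ) :
    ∃ a ∈ C, ∀ k, q k a ≤ 0 := by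
  -- The first `n` constraints with slack `1 / (n + 1)`: nonempty by the finite case, decreasing in
  -- `n`, and exact in the limit.
  set D : ℕ → Set E := fun n => {a ∈ C | ∀ k < n, q k a ≤ 1 / ((n : ℝ) + 1)} with hD
  have hCne : C.Nonempty := by
    obtain ⟨a, ha, -⟩ := h 0 (fun _ => 0) (fun _ => le_rfl) 1 one_pos
    exact ⟨a, ha⟩
  have hsub : ∀ n, D n ⊆ C := fun n a ha => ha.1
  have hanti : Antitone D := by
    intro m n hmn a ha
    refine ⟨ha.1, fun k hk => (ha.2 k (hk.trans_le hmn)).trans ?_⟩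
    gcongr
  have hne : ∀ n, (D n).Nonempty := by
    intro n
    obtain ⟨a, ha, hlt⟩ := exists_forall_lt_of_forall_sum_lt (q := fun (k : Fin n) => q k) hCne hcv
      (fun k => (hq k).subset (subset_univ _) hcv) (h n) (δ := 1 / ((n : ℝ) + 1)) (by positivity)
    exact ⟨a, ha, fun k hk => (hlt ⟨k, hk⟩).le⟩
  have hset : ∀ n, D n = C ∩ ⋂ k, ⋂ (_ : k < n), {a | q k a ≤ 1 / ((n : ℝ) + 1)} := by
    intro n; ext a; simp [hD]
  have hDcl : ∀ n, IsClosed (D n) := fun n => by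
    rw [hset]
    exact hcl.inter (isClosed_iInter fun k => isClosed_iInter fun _ =>
      isClosed_le (hqc k) continuous_const)
  have hDcv : ∀ n, Convex ℝ (D n) := fun n => by
    rw [hset]
    refine hcv.inter (convex_iInter fun k => convex_iInter fun _ => ?_)
    simpa using (hq k).convex_le (1 / ((n : ℝ) + 1))
  obtain ⟨a, ha⟩ := nonempty_iInter_of_convex hanti hne hDcl hDcv (hb.subset (hsub 0))
  rw [mem_iInter] at ha
  refine ⟨a, (ha 0).1, fun k => ?_⟩
  refine ge_of_tendsto tendsto_one_div_add_atTop_nhds_zero_nat ?_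
  filter_upwards [eventually_gt_atTop k] with n hn using (ha n).2 k hn

end Minimax

/-! ### Square roots, polar decomposition and the trace norm of `√α √β`. -/

section Fidelity

open ContinuousLinearMap (adjoint)

variable {E : Type*} [NormedAddCommGroup E] [InnerProductSpace ℂ E] [CompleteSpace E]

/-- The square root of a positive operator. -/
def posSqrt (T : E →L[ℂ] E) : E →L[ℂ] E :=
  CFC.sqrt T

theorem posSqrt_nonneg (T : E →L[ℂ] E) : 0 ≤ posSqrt T :=
  CFC.sqrt_nonneg T

theorem posSqrt_mul_self (T : E →L[ℂ] E) (hT : 0 ≤ T) : posSqrt T * posSqrt T = T :=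
  CFC.sqrt_mul_sqrt_self T hT

theorem fidelity_eq (τ ω : E →L[ℂ] E) :
    fidelity τ ω = (traceNorm (posSqrt τ * posSqrt ω)).toReal ^ 2 := rfl

theorem adjoint_posSqrt (T : E →L[ℂ] E) : adjoint (posSqrt T) = posSqrt T :=
  (IsSelfAdjoint.of_nonneg (posSqrt_nonneg T)).adjoint_eq

theorem posSqrt_eq_of_mul_self {S T : E →L[ℂ] E} (h : S * S = T) (hS : 0 ≤ S) : posSqrt T = S :=
  CFC.sqrt_unique h hS

theorem posSqrt_apply_posSqrt {T : E →L[ℂ] E} (hT : 0 ≤ T) (x : E) :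
    posSqrt T (posSqrt T x) = T x := by
  conv_rhs => rw [← posSqrt_mul_self T hT]
  rfl

theorem inner_apply_eq_norm_posSqrt_sq {T : E →L[ℂ] E} (hT : 0 ≤ T) (x : E) :
    ⟪x, T x⟫_ℂ = ((‖posSqrt T x‖ ^ 2 : ℝ) : ℂ) := by
  rw [← posSqrt_apply_posSqrt hT, ← ContinuousLinearMap.adjoint_inner_left, adjoint_posSqrt,
    inner_self_eq_norm_sq_to_K]
  norm_cast

theorem le_iff_re_inner {S T : E →L[ℂ] E} (hS : IsSelfAdjoint S) (hT : IsSelfAdjoint T) :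
    S ≤ T ↔ ∀ x, (⟪x, S x⟫_ℂ).re ≤ (⟪x, T x⟫_ℂ).re := by
  rw [ContinuousLinearMap.le_def, ContinuousLinearMap.isPositive_def']
  constructor
  · rintro ⟨-, h⟩ x
    have := h x
    rw [ContinuousLinearMap.reApplyInnerSelf_apply, sub_apply,
      inner_sub_left, map_sub, inner_re_symm, inner_re_symm (S x)] at this
    simpa using this
  · intro h
    refine ⟨hT.sub hS, fun x => ?_⟩
    rw [ContinuousLinearMap.reApplyInnerSelf_apply, sub_apply,
      inner_sub_left, map_sub, inner_re_symm, inner_re_symm (S x)]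
    simpa using h x

theorem traceNorm_of_nonneg {T : E →L[ℂ] E} (hT : 0 ≤ T) :
    traceNorm T = hsSq (posSqrt T) := by
  unfold traceNorm hsSq
  congr 1; funext i
  rw [CFC.abs_of_nonneg T hT, inner_apply_eq_norm_posSqrt_sq hT, Complex.ofReal_re]

theorem trace_of_nonneg {T : E →L[ℂ] E} (hT : 0 ≤ T) :
    trace T = ((hsSq (posSqrt T)).toReal : ℂ) := by
  rw [← hsInner_self]
  unfold trace hsInner
  congr 1; funext i
  rw [← posSqrt_apply_posSqrt hT, ← ContinuousLinearMap.adjoint_inner_left, adjoint_posSqrt]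

theorem hsSq_posSqrt_ne_top {T : E →L[ℂ] E} (hT : 0 ≤ T) (h : IsTraceClass T) :
    hsSq (posSqrt T) ≠ ⊤ := by
  rw [← traceNorm_of_nonneg hT]; exact h.ne

theorem traceNorm_eq (X : E →L[ℂ] E) : traceNorm X = hsSq (posSqrt (CFC.abs X)) := by
  rw [← traceNorm_of_nonneg (CFC.abs_nonneg X)]
  unfold traceNorm
  rw [CFC.abs_of_nonneg _ (CFC.abs_nonneg X)]

theorem norm_abs_apply (X : E →L[ℂ] E) (x : E) : ‖CFC.abs X x‖ = ‖X x‖ := by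
  have h : ⟪CFC.abs X x, CFC.abs X x⟫_ℂ = ⟪X x, X x⟫_ℂ := by
    rw [← ContinuousLinearMap.adjoint_inner_right, ← ContinuousLinearMap.adjoint_inner_right X,
      (IsSelfAdjoint.of_nonneg (CFC.abs_nonneg X)).adjoint_eq]
    congr 1
    exact DFunLike.congr_fun (CFC.abs_mul_abs X) x
  rw [inner_self_eq_norm_sq_to_K, inner_self_eq_norm_sq_to_K] at h
  have h' : ‖CFC.abs X x‖ ^ 2 = ‖X x‖ ^ 2 := by exact_mod_cast h
  exact (sq_eq_sq₀ (norm_nonneg _) (norm_nonneg _)).1 h'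

theorem norm_adjoint (V : E →L[ℂ] E) : ‖adjoint V‖ = ‖V‖ := LinearIsometryEquiv.norm_map _ _

/-- The trace norm of a product of Hilbert–Schmidt square roots is a Hilbert–Schmidt pairing. -/
theorem exists_traceNorm_eq_hsInner {α β : E →L[ℂ] E} (hα : hsSq (posSqrt α) ≠ ⊤)
    (hβ : hsSq (posSqrt β) ≠ ⊤) :
    ∃ V : E →L[ℂ] E, ‖V‖ ≤ 1 ∧ traceNorm (posSqrt α * posSqrt β) ≠ ⊤ ∧
      hsInner (posSqrt α ∘L V) (posSqrt β) =
        ((traceNorm (posSqrt α * posSqrt β)).toReal : ℂ) := by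
  set X := posSqrt α * posSqrt β with hX
  set S := posSqrt (CFC.abs X) with hS
  -- Polar decomposition as `|X| = V X`; hence `⟨√α V* x, √β x⟩ = ⟨x, |X| x⟩`, and summability of
  -- the left side shows that `X` is trace class.
  obtain ⟨V, hV, hVX⟩ := exists_contraction_comp_eq (CFC.abs X) X
    fun x => (norm_abs_apply X x).le
  have key : ∀ x, ⟪(posSqrt α ∘L adjoint V) x, posSqrt β x⟫_ℂ = ⟪S x, S x⟫_ℂ := by
    intro x
    have h1 : V (posSqrt α (posSqrt β x)) = CFC.abs X x := DFunLike.congr_fun hVX x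
    rw [ContinuousLinearMap.comp_apply, ← ContinuousLinearMap.adjoint_inner_right, adjoint_posSqrt,
      ContinuousLinearMap.adjoint_inner_left, h1, inner_apply_eq_norm_posSqrt_sq (CFC.abs_nonneg X),
      inner_self_eq_norm_sq_to_K]
    norm_cast
  have hfin : hsSq S ≠ ⊤ := by
    have hs := summable_hsInner_norm (hsSq_comp_ne_top' hα (adjoint V)) hβ
    simp only [key] at hs
    have hs' : Summable fun i => ‖S (basis E i)‖ ^ 2 := by
      refine hs.congr fun i => ?_
      rw [inner_self_eq_norm_sq_to_K]
      simp
    exact hs'.tsum_ofReal_ne_top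
  refine ⟨adjoint V, by rwa [norm_adjoint], by rwa [traceNorm_eq], ?_⟩
  rw [traceNorm_eq, ← hsInner_self]
  unfold hsInner
  simp only [key]
  rfl

/-- A Hilbert–Schmidt pairing of factors dominated by `√α` and `√β` is bounded by the trace norm
of `√α √β`. -/
theorem re_hsInner_le_traceNorm {α β T : E →L[ℂ] E} (hα : hsSq (posSqrt α) ≠ ⊤)
    (hβ : hsSq (posSqrt β) ≠ ⊤) (hT : ∀ x, ‖adjoint T x‖ ≤ ‖posSqrt α x‖) :
    (hsInner T (posSqrt β)).re ≤ (traceNorm (posSqrt α * posSqrt β)).toReal := by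
  obtain ⟨-, -, hfin, -⟩ := exists_traceNorm_eq_hsInner hα hβ
  set X := posSqrt α * posSqrt β with hX
  set S := posSqrt (CFC.abs X) with hS
  rw [traceNorm_eq] at hfin ⊢
  obtain ⟨W, hW, hWX⟩ := exists_contraction_comp_eq X (CFC.abs X)
    fun x => (norm_abs_apply X x).ge
  obtain ⟨V, hV, hVT⟩ := exists_contraction_comp_eq (adjoint T) (posSqrt α) hT
  have hU : ‖adjoint (V ∘L W)‖ ≤ 1 := by
    rw [norm_adjoint]
    exact (ContinuousLinearMap.opNorm_comp_le _ _).trans (mul_le_one₀ hV (norm_nonneg _) hW)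
  -- With `X = W |X|` and `T* = V √α`, one has `T* √β = V W |X|`; splitting `|X| = S S` leaves a
  -- pairing of `S` with a contracted copy of itself.
  have key : hsInner T (posSqrt β) = hsInner (S ∘L adjoint (V ∘L W)) S := by
    unfold hsInner
    congr 1; funext i
    set x := basis E i
    have h1 : W (CFC.abs X x) = posSqrt α (posSqrt β x) := DFunLike.congr_fun hWX x
    have h2 : adjoint T (posSqrt β x) = V (W (CFC.abs X x)) := by
      rw [h1, ← hVT]; rfl
    rw [← ContinuousLinearMap.adjoint_inner_right, h2, ContinuousLinearMap.comp_apply,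
      ← ContinuousLinearMap.adjoint_inner_right, adjoint_posSqrt,
      posSqrt_apply_posSqrt (CFC.abs_nonneg X), ContinuousLinearMap.adjoint_inner_left]
    rfl
  have h3 := hsSq_comp_le_of_norm_le_one S hU
  have h4 := norm_hsInner_le (hsSq_comp_ne_top' hfin (adjoint (V ∘L W))) hfin
  have h5 := ENNReal.toReal_mono hfin h3
  calc (hsInner T (posSqrt β)).re ≤ ‖hsInner T (posSqrt β)‖ := Complex.re_le_norm _
    _ ≤ _ := by rw [key]; linarith

end Fidelity

/-! ### Operators on `H ⊕ ℂ`. -/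

section DirectSum

open ContinuousLinearMap (adjoint)

variable {H : Type*} [NormedAddCommGroup H] [InnerProductSpace ℂ H] [CompleteSpace H]

/-- The isometric inclusion of `H` into `H ⊕ ℂ`. -/
def inlL2 (H : Type*) [NormedAddCommGroup H] [InnerProductSpace ℂ H] :
    H →L[ℂ] WithLp 2 (H × ℂ) :=
  ((WithLp.prodContinuousLinearEquiv 2 ℂ H ℂ).symm : H × ℂ →L[ℂ] WithLp 2 (H × ℂ)) ∘L
    ContinuousLinearMap.inl ℂ H ℂ

theorem inlL2_apply (x : H) : inlL2 H x = WithLp.toLp 2 (x, 0) := rfl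

theorem adjoint_inlL2_apply (y : WithLp 2 (H × ℂ)) : adjoint (inlL2 H) y = y.fst := by
  refine ext_inner_left ℂ fun x => ?_
  rw [ContinuousLinearMap.adjoint_inner_right, inlL2_apply]
  simp

theorem adjoint_inlL2_comp_inlL2 :
    adjoint (inlL2 H) ∘L inlL2 H = ContinuousLinearMap.id ℂ H := by
  ext x
  rw [ContinuousLinearMap.comp_apply, adjoint_inlL2_apply, inlL2_apply]
  rfl

theorem directSum_apply (τ : H →L[ℂ] H) (c : ℂ) (y : WithLp 2 (H × ℂ)) :
    directSum τ c y = WithLp.toLp 2 (τ y.fst, c * y.snd) := rfl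

theorem inner_directSum (τ : H →L[ℂ] H) (c : ℂ) (y : WithLp 2 (H × ℂ)) :
    ⟪y, directSum τ c y⟫_ℂ = ⟪y.fst, τ y.fst⟫_ℂ + c * (‖y.snd‖ ^ 2 : ℝ) := by
  rw [directSum_apply, WithLp.prod_inner_apply]
  have : (y.snd * (starRingEnd ℂ) y.snd) = ((‖y.snd‖ ^ 2 : ℝ) : ℂ) := by
    rw [Complex.mul_conj, Complex.normSq_eq_norm_sq]
  simp [← this]
  ring

theorem directSum_zero (τ : H →L[ℂ] H) :
    directSum τ 0 = inlL2 H ∘L τ ∘L adjoint (inlL2 H) := by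
  ext1 y
  rw [directSum_apply, ContinuousLinearMap.comp_apply, ContinuousLinearMap.comp_apply,
    adjoint_inlL2_apply, inlL2_apply, zero_mul]

theorem directSum_comp (τ ω : H →L[ℂ] H) (c d : ℂ) :
    directSum τ c * directSum ω d = directSum (τ * ω) (c * d) := by
  ext1 y
  rw [mul_apply_eq_comp, directSum_apply, directSum_apply, directSum_apply]
  simp [mul_assoc]

theorem directSum_nonneg {τ : H →L[ℂ] H} (hτ : 0 ≤ τ) {t : ℝ} (ht : 0 ≤ t) :
    0 ≤ directSum τ t := by
  rw [ContinuousLinearMap.nonneg_iff_isPositive, ContinuousLinearMap.isPositive_iff]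
  have hsym := ((ContinuousLinearMap.nonneg_iff_isPositive _).1 hτ).isSymmetric
  refine ⟨fun x y => ?_, fun y => ?_⟩
  · have := hsym x.fst y.fst
    simp only [ContinuousLinearMap.coe_coe] at this ⊢
    rw [directSum_apply, directSum_apply]
    simp only [WithLp.prod_inner_apply]
    simp [this]
    ring
  · rw [← inner_conj_symm, inner_directSum, inner_apply_eq_norm_posSqrt_sq hτ]
    rw [← Complex.ofReal_mul, ← Complex.ofReal_add, Complex.conj_ofReal, Complex.zero_le_real]
    positivity

theorem posSqrt_directSum {τ : H →L[ℂ] H} (hτ : 0 ≤ τ) {t : ℝ} (ht : 0 ≤ t) :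
    posSqrt (directSum τ t) = directSum (posSqrt τ) (Real.sqrt t : ℝ) := by
  refine posSqrt_eq_of_mul_self ?_ (directSum_nonneg (posSqrt_nonneg τ) (Real.sqrt_nonneg t))
  rw [directSum_comp, posSqrt_mul_self τ hτ, ← Complex.ofReal_mul, Real.mul_self_sqrt ht]

/-- The fixed basis of `H ⊕ ℂ` need not respect the decomposition, so each term is split: the `H`
part is the norm of `S J*`, where `J` is the inclusion, and the scalar part is Parseval for `(0,
1)`. -/
theorem hsSq_directSum_ne_top {S : H →L[ℂ] H} (hS : hsSq S ≠ ⊤) (s : ℂ) :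
    hsSq (directSum S s) ≠ ⊤ := by
  have h1 : hsSq (S ∘L adjoint (inlL2 H)) ≠ ⊤ := hsSq_comp_ne_top' hS _
  set e : WithLp 2 (H × ℂ) := WithLp.toLp 2 (0, 1) with he
  have h2 := parseval (basis (WithLp 2 (H × ℂ))) e
  have h3 : hsSq (directSum S s) =
      hsSq (S ∘L adjoint (inlL2 H)) + ENNReal.ofReal (‖s‖ ^ 2) * ENNReal.ofReal (‖e‖ ^ 2) := by
    rw [h2, ← ENNReal.tsum_mul_left]
    unfold hsSq
    rw [← ENNReal.tsum_add]
    congr 1; funext i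
    set f := basis (WithLp 2 (H × ℂ)) i
    have h4 : ‖⟪f, e⟫_ℂ‖ = ‖f.snd‖ := by
      rw [WithLp.prod_inner_apply]
      simp [he]
    rw [← ENNReal.ofReal_mul (by positivity), ← ENNReal.ofReal_add (by positivity) (by positivity),
      h4, directSum_apply, WithLp.prod_norm_sq_eq_of_L2, ContinuousLinearMap.comp_apply,
      adjoint_inlL2_apply, ← mul_pow, ← norm_mul]
    rfl
  rw [h3]
  exact ENNReal.add_ne_top.2 ⟨h1, ENNReal.mul_ne_top ENNReal.ofReal_ne_top ENNReal.ofReal_ne_top⟩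

end DirectSum

/-! ### The smoothing ball in terms of Hilbert–Schmidt factors. -/

section Purification

open ContinuousLinearMap (adjoint)

variable {H : Type*} [NormedAddCommGroup H] [InnerProductSpace ℂ H] [CompleteSpace H]

theorem norm_adjoint_inlL2_le (y : WithLp 2 (H × ℂ)) : ‖adjoint (inlL2 H) y‖ ≤ ‖y‖ := by
  rw [adjoint_inlL2_apply]
  exact WithLp.norm_fst_le ..

/-- The trace deficit of a substate is a non-negative real number. -/
theorem IsSubstate.exists_trace_eq {τ : H →L[ℂ] H} (hτ : IsSubstate τ) :
    ∃ t : ℝ, 0 ≤ t ∧ 1 - trace τ = t := by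
  obtain ⟨h0, -, h1⟩ := hτ
  rw [trace_of_nonneg h0] at h1 ⊢
  exact ⟨1 - (hsSq (posSqrt τ)).toReal, by simpa using h1, by push_cast; rfl⟩

theorem posSqrt_directSum_zero {ρ : H →L[ℂ] H} (hρ : 0 ≤ ρ) :
    posSqrt (directSum ρ 0) = inlL2 H ∘L posSqrt ρ ∘L adjoint (inlL2 H) := by
  have := posSqrt_directSum hρ le_rfl
  rw [Real.sqrt_zero, Complex.ofReal_zero] at this
  rw [this, directSum_zero]

/-- A state has zero trace deficit, so its extension is `ρ ⊕ 0`; the square in the fidelity is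
removed to leave a bound on the trace norm, which is a linear pairing. -/
theorem sineDistance_le_iff {τ ρ : H →L[ℂ] H} (hρ : IsState ρ) {ε : ℝ}
    (hε : ε ∈ Set.Ioo (0 : ℝ) 1) :
    sineDistance τ ρ ≤ ε ↔ Real.sqrt (1 - ε ^ 2) ≤
      (traceNorm (posSqrt (directSum τ (1 - trace τ)) * posSqrt (directSum ρ 0))).toReal := by
  unfold sineDistance
  rw [fidelity_eq, hρ.2.2, sub_self, Real.sqrt_le_left hε.1.le, Real.sqrt_le_left ENNReal.toReal_nonneg,
    sub_le_comm]

theorem exists_hilbertSchmidt_of_sineDistance_le {τ ρ : H →L[ℂ] H} (hτ : IsSubstate τ)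
    (hρ : IsState ρ) {ε : ℝ} (hε : ε ∈ Set.Ioo (0 : ℝ) 1) (h : sineDistance τ ρ ≤ ε) :
    ∃ A : H →L[ℂ] H, hsSq A ≤ 1 ∧ (∀ x, ‖adjoint A x‖ ^ 2 ≤ (⟪x, τ x⟫_ℂ).re) ∧
      Real.sqrt (1 - ε ^ 2) ≤ (hsInner A (posSqrt ρ)).re := by
  rw [sineDistance_le_iff hρ hε] at h
  obtain ⟨t, ht, hte⟩ := hτ.exists_trace_eq
  rw [hte] at h
  set J := inlL2 H with hJ
  set α := directSum τ (t : ℂ) with hα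
  have hα0 : 0 ≤ α := directSum_nonneg hτ.1 ht
  have hρ' : hsSq (posSqrt ρ) ≠ ⊤ := hsSq_posSqrt_ne_top hρ.1 hρ.2.1
  have hαfin : hsSq (posSqrt α) ≠ ⊤ := by
    rw [hα, posSqrt_directSum hτ.1 ht]
    exact hsSq_directSum_ne_top (hsSq_posSqrt_ne_top hτ.1 hτ.2.1) _
  have hβ := posSqrt_directSum_zero hρ.1
  have hβfin : hsSq (posSqrt (directSum ρ 0)) ≠ ⊤ := by
    rw [hβ]; exact hsSq_comp_ne_top _ (hsSq_comp_ne_top' hρ' _)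
  obtain ⟨V, hV, -, hVe⟩ := exists_traceNorm_eq_hsInner hαfin hβfin
  set A : H →L[ℂ] H := (adjoint J ∘L (posSqrt α ∘L V)) ∘L J with hA
  have hAle : ∀ x, ‖adjoint A x‖ ^ 2 ≤ (⟪x, τ x⟫_ℂ).re := by
    intro x
    have h1 : adjoint A x = adjoint J (adjoint V (posSqrt α (J x))) := by
      simp only [hA, ContinuousLinearMap.adjoint_comp, ContinuousLinearMap.adjoint_adjoint,
        adjoint_posSqrt]
      rfl
    have h2 : ‖adjoint A x‖ ≤ ‖posSqrt α (J x)‖ := by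
      rw [h1]
      refine (norm_adjoint_inlL2_le _).trans (((adjoint V).le_opNorm _).trans ?_)
      rw [norm_adjoint]
      exact mul_le_of_le_one_left (norm_nonneg _) hV
    have h3 := inner_apply_eq_norm_posSqrt_sq hα0 (J x)
    rw [hα, inner_directSum] at h3
    have h4 : ⟪x, τ x⟫_ℂ = ((‖posSqrt α (J x)‖ ^ 2 : ℝ) : ℂ) := by
      rw [← h3, hJ, inlL2_apply]
      simp
    rw [h4, Complex.ofReal_re]
    gcongr
  refine ⟨A, ?_, hAle, ?_⟩
  · rw [← hsSq_adjoint]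
    have h5 : hsSq (adjoint A) ≤ hsSq (posSqrt τ) := by
      unfold hsSq
      refine ENNReal.tsum_le_tsum fun i => ENNReal.ofReal_le_ofReal ?_
      have := hAle (basis H i)
      rwa [inner_apply_eq_norm_posSqrt_sq hτ.1, Complex.ofReal_re] at this
    refine h5.trans ?_
    have h6 := hτ.2.2
    rw [trace_of_nonneg hτ.1, Complex.ofReal_re] at h6
    rw [← ENNReal.ofReal_toReal (hsSq_posSqrt_ne_top hτ.1 hτ.2.1), ← ENNReal.ofReal_one]
    exact ENNReal.ofReal_le_ofReal h6
  · have h7 : hsSq (posSqrt α ∘L V) ≠ ⊤ := hsSq_comp_ne_top' hαfin V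
    have h8 : hsInner (posSqrt α ∘L V) (posSqrt (directSum ρ 0)) = hsInner A (posSqrt ρ) := by
      rw [hβ, hA, hsInner_comp_right J (hsSq_comp_ne_top _ h7) hρ', hsInner_comp_left (adjoint J),
        ContinuousLinearMap.adjoint_adjoint]
    rw [← h8, hVe, Complex.ofReal_re]
    exact h

theorem isSubstate_comp_adjoint {A : H →L[ℂ] H} (hA : hsSq A ≤ 1) :
    IsSubstate (A ∘L adjoint A) := by
  have h0 : 0 ≤ A ∘L adjoint A :=
    (ContinuousLinearMap.nonneg_iff_isPositive _).2
      (ContinuousLinearMap.isPositive_self_comp_adjoint A)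
  have h1 : hsSq (posSqrt (A ∘L adjoint A)) = hsSq A := by
    rw [← hsSq_adjoint A]
    unfold hsSq
    congr 1; funext i; congr 1
    rw [← Complex.ofReal_inj, ← inner_apply_eq_norm_posSqrt_sq h0, ContinuousLinearMap.comp_apply,
      ← ContinuousLinearMap.adjoint_inner_left, inner_self_eq_norm_sq_to_K]
    norm_cast
  refine ⟨h0, ?_, ?_⟩
  · unfold IsTraceClass
    rw [traceNorm_of_nonneg h0, h1]
    exact hA.trans_lt ENNReal.one_lt_top
  · rw [trace_of_nonneg h0, h1, Complex.ofReal_re]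
    exact ENNReal.toReal_le_of_le_ofReal zero_le_one (by simpa using hA)

theorem sineDistance_comp_adjoint_le {A ρ : H →L[ℂ] H} (hA : hsSq A ≤ 1) (hρ : IsState ρ) {ε : ℝ}
    (hε : ε ∈ Set.Ioo (0 : ℝ) 1) (h : Real.sqrt (1 - ε ^ 2) ≤ (hsInner A (posSqrt ρ)).re) :
    sineDistance (A ∘L adjoint A) ρ ≤ ε := by
  have hτ := isSubstate_comp_adjoint hA
  rw [sineDistance_le_iff hρ hε]
  set τ := A ∘L adjoint A with hτdef
  obtain ⟨t, ht, hte⟩ := hτ.exists_trace_eq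
  rw [hte]
  set J := inlL2 H with hJ
  set α := directSum τ (t : ℂ) with hα
  have hα0 : 0 ≤ α := directSum_nonneg hτ.1 ht
  have hρ' : hsSq (posSqrt ρ) ≠ ⊤ := hsSq_posSqrt_ne_top hρ.1 hρ.2.1
  have hA' : hsSq A ≠ ⊤ := ne_top_of_le_ne_top ENNReal.one_ne_top hA
  have hαfin : hsSq (posSqrt α) ≠ ⊤ := by
    rw [hα, posSqrt_directSum hτ.1 ht]
    exact hsSq_directSum_ne_top (hsSq_posSqrt_ne_top hτ.1 hτ.2.1) _
  have hβ := posSqrt_directSum_zero hρ.1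
  have hβfin : hsSq (posSqrt (directSum ρ 0)) ≠ ⊤ := by
    rw [hβ]; exact hsSq_comp_ne_top _ (hsSq_comp_ne_top' hρ' _)
  refine h.trans ?_
  have h8 : hsInner (J ∘L (A ∘L adjoint J)) (posSqrt (directSum ρ 0)) =
      hsInner A (posSqrt ρ) := by
    rw [hβ, hsInner_comp_left, ← ContinuousLinearMap.comp_assoc, adjoint_inlL2_comp_inlL2,
      ContinuousLinearMap.id_comp, hsInner_comp_right _ hA' (hsSq_comp_ne_top' hρ' _),
      ContinuousLinearMap.adjoint_adjoint, ContinuousLinearMap.comp_assoc,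
      adjoint_inlL2_comp_inlL2, ContinuousLinearMap.comp_id]
  rw [← h8]
  -- The factor `J A J*` is dominated by `√α` because `α = A A* ⊕ t` with `t ≥ 0`.
  refine re_hsInner_le_traceNorm hαfin hβfin fun y => ?_
  refine le_of_sq_le_sq ?_ (norm_nonneg _)
  have h9 : adjoint (J ∘L (A ∘L adjoint J)) y = J (adjoint A y.fst) := by
    simp only [ContinuousLinearMap.adjoint_comp, ContinuousLinearMap.adjoint_adjoint]
    rw [← adjoint_inlL2_apply]
    rfl
  have h10 : ‖J (adjoint A y.fst)‖ ^ 2 = ‖adjoint A y.fst‖ ^ 2 := by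
    rw [hJ, inlL2_apply, WithLp.prod_norm_sq_eq_of_L2]
    simp
  have h11 := inner_apply_eq_norm_posSqrt_sq hα0 y
  have h12 : ⟪y.fst, τ y.fst⟫_ℂ = ((‖adjoint A y.fst‖ ^ 2 : ℝ) : ℂ) := by
    rw [hτdef, ContinuousLinearMap.comp_apply, ← ContinuousLinearMap.adjoint_inner_left,
      inner_self_eq_norm_sq_to_K]
    norm_cast
  rw [hα, inner_directSum, h12, ← Complex.ofReal_mul, ← Complex.ofReal_add,
    Complex.ofReal_inj] at h11
  rw [h9, h10, ← h11]
  exact le_add_of_nonneg_right (by positivity)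

end Purification

/-! ### Quadratic constraints on a half-space section of the unit ball. -/

section QuadraticMinimax

variable {E G : Type*} [NormedAddCommGroup E] [InnerProductSpace ℂ E] [CompleteSpace E]
  [NormedAddCommGroup G] [InnerProductSpace ℂ G]

/-- The maps are conjugate-linear because they will be `A ↦ A* vₖ`; this is harmless, as convexity
only involves real scalars. -/
theorem exists_forall_norm_sq_le (L : ℕ → E →L⋆[ℂ] G) (s : ℕ → ℝ) (r : E) (c : ℝ)
    (h : ∀ (n : ℕ) (w : Fin n → ℝ), (∀ k, 0 ≤ w k) → ∀ δ > 0, ∃ a : E, (‖a‖ ≤ 1 ∧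
      c ≤ (⟪a, r⟫_ℂ).re) ∧ ∑ k, w k * ‖L k a‖ ^ 2 < ∑ k, w k * s k + δ) :
    ∃ a : E, (‖a‖ ≤ 1 ∧ c ≤ (⟪a, r⟫_ℂ).re) ∧ ∀ k, ‖L k a‖ ^ 2 ≤ s k := by
  set C : Set E := {a | ‖a‖ ≤ 1 ∧ c ≤ (⟪a, r⟫_ℂ).re} with hC
  have hcl : IsClosed C :=
    (isClosed_le continuous_norm continuous_const).inter
      (isClosed_le continuous_const (Complex.continuous_re.comp
        (continuous_id.inner continuous_const)))
  have hb : Bornology.IsBounded C :=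
    (Metric.isBounded_closedBall (x := (0 : E)) (r := 1)).subset fun a ha => by
      simpa using ha.1
  have hcv : Convex ℝ C := by
    rintro a ⟨ha, ha'⟩ b ⟨hb, hb'⟩ u v hu hv huv
    refine ⟨?_, ?_⟩
    · have := (convex_closedBall (0 : E) 1) (x := a) (by simpa using ha) (y := b)
        (by simpa using hb) hu hv huv
      simpa using this
    · rw [inner_add_left, Complex.add_re]
      have hr : ∀ (t : ℝ) (z : E), (⟪t • z, r⟫_ℂ).re = t * (⟪z, r⟫_ℂ).re := fun t z => by
        rw [← Complex.coe_smul, inner_smul_left]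
        simp
      rw [hr, hr]
      calc c = u * c + v * c := by rw [← add_mul, huv, one_mul]
        _ ≤ _ := by gcongr
  have hLsmul : ∀ k (t : ℝ) (z : E), L k (t • z) = t • L k z := fun k t z => by
    rw [← Complex.coe_smul, map_smulₛₗ, Complex.conj_ofReal, Complex.coe_smul]
  have hq : ∀ k, ConvexOn ℝ Set.univ fun a => ‖L k a‖ ^ 2 - s k := by
    intro k
    have h1 : ConvexOn ℝ Set.univ fun a => ‖L k a‖ := by
      refine ⟨convex_univ, fun a _ b _ u v hu hv _ => ?_⟩
      simp only [map_add, hLsmul]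
      refine (norm_add_le _ _).trans_eq ?_
      rw [norm_smul, norm_smul, Real.norm_of_nonneg hu, Real.norm_of_nonneg hv]
      rfl
    have h2 := (h1.pow (fun _ _ => norm_nonneg _) 2).add_const (-s k)
    simp only [sub_eq_add_neg]
    exact h2
  have hqc : ∀ k, Continuous fun a => ‖L k a‖ ^ 2 - s k := fun k => by fun_prop
  let _ : InnerProductSpace ℝ E := InnerProductSpace.complexToReal
  obtain ⟨a, ha, hak⟩ := exists_forall_le_zero_of_forall_sum_lt hcl hcv hb hq hqc (by
    intro n w hw δ hδ
    obtain ⟨a, ha, hlt⟩ := h n w hw δ hδ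
    refine ⟨a, ha, ?_⟩
    simp only [mul_sub, Finset.sum_sub_distrib]
    linarith)
  exact ⟨a, ha, fun k => sub_nonpos.1 (hak k)⟩

end QuadraticMinimax

/-! ### Hilbert–Schmidt operators as square-summable families. -/

section Sequences

open ContinuousLinearMap (adjoint)

variable {H : Type*} [NormedAddCommGroup H] [InnerProductSpace ℂ H] [CompleteSpace H]

/-- Square-summable families in `H`, indexed by the fixed basis. -/
abbrev L2Family (H : Type*) [NormedAddCommGroup H] [InnerProductSpace ℂ H] [CompleteSpace H] :=
  lp (fun _ : basisIndex H => H) 2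

theorem memℓp_two_of_summable {ι F : Type*} [NormedAddCommGroup F] {f : ι → F}
    (h : Summable fun i => ‖f i‖ ^ 2) : Memℓp f 2 :=
  memℓp_gen (by simpa using h)

theorem hasSum_norm_sq {ι F : Type*} [NormedAddCommGroup F] [InnerProductSpace ℂ F]
    (a : lp (fun _ : ι => F) 2) : HasSum (fun i => ‖a i‖ ^ 2) (‖a‖ ^ 2) := by
  have h := Complex.hasSum_re (lp.hasSum_inner (𝕜 := ℂ) a a)
  rw [inner_self_eq_norm_sq_to_K] at h
  convert h using 1
  · funext i
    rw [inner_self_eq_norm_sq_to_K]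
    norm_cast
  · norm_cast

theorem summable_norm_inner_apply_sq (a : L2Family H) (v : H) :
    Summable fun i => ‖⟪a i, v⟫_ℂ‖ ^ 2 := by
  refine Summable.of_nonneg_of_le (fun _ => by positivity) (fun i => ?_)
    ((hasSum_norm_sq a).summable.mul_right (‖v‖ ^ 2))
  rw [← mul_pow]
  gcongr
  exact norm_inner_le_norm _ _

/-- The coefficients of a vector against a square-summable family. -/
def coeffs (a : L2Family H) (v : H) : lp (fun _ : basisIndex H => ℂ) 2 :=
  ⟨fun i => ⟪a i, v⟫_ℂ, memℓp_two_of_summable (summable_norm_inner_apply_sq a v)⟩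

theorem norm_coeffs_le (a : L2Family H) (v : H) : ‖coeffs a v‖ ≤ ‖a‖ * ‖v‖ := by
  refine le_of_sq_le_sq ?_ (by positivity)
  rw [mul_pow]
  refine hasSum_le (fun i => ?_) (hasSum_norm_sq (coeffs a v))
    ((hasSum_norm_sq a).mul_right (‖v‖ ^ 2))
  rw [← mul_pow]
  gcongr
  exact norm_inner_le_norm (a i) v

/-- The analysis operator `v ↦ ∑ᵢ ⟨aᵢ, v⟩ eᵢ` of a square-summable family. -/
def analysis : L2Family H →L⋆[ℂ] H →L[ℂ] H :=
  LinearMap.mkContinuous₂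
    (LinearMap.mk₂'ₛₗ (starRingEnd ℂ) (RingHom.id ℂ)
      (fun a v => (basis H).repr.symm (coeffs a v))
      (fun a b v => by
        rw [← map_add]; congr 1; ext i; exact inner_add_left _ _ _)
      (fun c a v => by
        rw [← map_smul]; congr 1; ext i; exact inner_smul_left _ _ _)
      (fun a v w => by
        rw [← map_add]; congr 1; ext i; exact inner_add_right _ _ _)
      (fun c a v => by
        rw [RingHom.id_apply, ← map_smul]; congr 1; ext i; exact inner_smul_right _ _ _)) 1
    (fun a v => by
      rw [one_mul, LinearMap.mk₂'ₛₗ_apply, LinearIsometryEquiv.norm_map]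
      exact norm_coeffs_le a v)

theorem inner_basis_analysis (a : L2Family H) (v : H) (i : basisIndex H) :
    ⟪basis H i, analysis a v⟫_ℂ = ⟪a i, v⟫_ℂ := by
  rw [← (basis H).repr_apply_apply]
  change (basis H).repr ((basis H).repr.symm (coeffs a v)) i = _
  rw [LinearIsometryEquiv.apply_symm_apply]
  rfl

theorem adjoint_analysis_basis (a : L2Family H) (i : basisIndex H) :
    adjoint (analysis a) (basis H i) = a i := by
  refine ext_inner_right ℂ fun v => ?_
  rw [ContinuousLinearMap.adjoint_inner_left, inner_basis_analysis]

/-- Families `i ↦ A eᵢ` supply the Hilbert space structure for the minimax argument; in this model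
`analysis` is the map `A ↦ A*`. -/
theorem analysis_eq_adjoint {A : H →L[ℂ] H} {a : L2Family H} (h : ∀ i, a i = A (basis H i)) :
    analysis a = adjoint A := by
  ext v
  apply (basis H).repr.injective
  ext i
  rw [(basis H).repr_apply_apply, (basis H).repr_apply_apply, inner_basis_analysis, h,
    ContinuousLinearMap.adjoint_inner_right]

theorem hsSq_eq_of_apply_basis {A : H →L[ℂ] H} {a : L2Family H}
    (h : ∀ i, a i = A (basis H i)) : hsSq A = ENNReal.ofReal (‖a‖ ^ 2) := by
  unfold hsSq
  simp only [← h]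
  rw [← (hasSum_norm_sq a).tsum_eq, ENNReal.ofReal_tsum_of_nonneg (fun _ => by positivity)
    (hasSum_norm_sq a).summable]

theorem hsSq_le_one_iff {A : H →L[ℂ] H} {a : L2Family H}
    (h : ∀ i, a i = A (basis H i)) : hsSq A ≤ 1 ↔ ‖a‖ ≤ 1 := by
  rw [hsSq_eq_of_apply_basis h, ENNReal.ofReal_le_one, sq_le_one_iff₀ (norm_nonneg _)]

theorem inner_eq_hsInner {A B : H →L[ℂ] H} {a b : L2Family H}
    (ha : ∀ i, a i = A (basis H i)) (hb : ∀ i, b i = B (basis H i)) :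
    ⟪a, b⟫_ℂ = hsInner A B := by
  rw [lp.inner_eq_tsum]
  unfold hsInner
  simp only [ha, hb]

theorem exists_family {A : H →L[ℂ] H} (hA : hsSq A ≠ ⊤) :
    ∃ a : L2Family H, ∀ i, a i = A (basis H i) :=
  ⟨⟨fun i => A (basis H i), memℓp_two_of_summable (summable_norm_sq hA)⟩, fun _ => rfl⟩

end Sequences

/-! ### The trace pairing and finite-rank dual operators. -/

section Duality

open ContinuousLinearMap (adjoint)

variable {H : Type*} [NormedAddCommGroup H] [InnerProductSpace ℂ H] [CompleteSpace H]

/-- Cyclicity applied to the square roots; the right side makes the trace visibly real, non-negative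
and monotone in `τ`. -/
theorem trace_comp_eq {M τ : H →L[ℂ] H} (hM : 0 ≤ M) (hτ : 0 ≤ τ) (hτ' : IsTraceClass τ) :
    trace (M ∘L τ) = ((hsSq (posSqrt τ ∘L posSqrt M)).toReal : ℂ) := by
  have h0 := hsSq_posSqrt_ne_top hτ hτ'
  have h1 : trace (M ∘L τ) = hsInner ((posSqrt τ ∘L posSqrt M) ∘L posSqrt M) (posSqrt τ) := by
    unfold trace hsInner
    congr 1; funext i
    set x := basis H i
    have hMsa : adjoint M = M := (IsSelfAdjoint.of_nonneg hM).adjoint_eq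
    simp only [ContinuousLinearMap.comp_apply]
    rw [posSqrt_apply_posSqrt hM, ← ContinuousLinearMap.adjoint_inner_right (posSqrt τ),
      adjoint_posSqrt, posSqrt_apply_posSqrt hτ, ← ContinuousLinearMap.adjoint_inner_left, hMsa]
  rw [h1, hsInner_comp_right _ (hsSq_comp_ne_top' h0 _) h0, adjoint_posSqrt, hsInner_self]

theorem hsSq_posSqrt_comp_le {τ σ T : H →L[ℂ] H} (hτ : 0 ≤ τ) (hσ : 0 ≤ σ) {lam : ℝ≥0}
    (h : τ ≤ ((lam : ℝ) : ℂ) • σ) :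
    hsSq (posSqrt τ ∘L T) ≤ lam * hsSq (posSqrt σ ∘L T) := by
  unfold hsSq
  rw [← ENNReal.tsum_mul_left]
  refine ENNReal.tsum_le_tsum fun i => ?_
  rw [← ENNReal.ofReal_coe_nnreal, ← ENNReal.ofReal_mul lam.coe_nonneg]
  refine ENNReal.ofReal_le_ofReal ?_
  set x := T (basis H i) with hx
  have h1 := ((ContinuousLinearMap.le_def _ _).1 h).re_inner_nonneg_right x
  rw [sub_apply, smul_apply, inner_sub_right, inner_smul_right,
    inner_apply_eq_norm_posSqrt_sq hτ, inner_apply_eq_norm_posSqrt_sq hσ, ← Complex.ofReal_mul,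
    ← Complex.ofReal_sub] at h1
  have h2 : 0 ≤ (lam : ℝ) * ‖posSqrt σ x‖ ^ 2 - ‖posSqrt τ x‖ ^ 2 := h1
  simpa [← hx] using h2

theorem re_trace_comp_le {M τ σ : H →L[ℂ] H} (hM : 0 ≤ M) (hτ : 0 ≤ τ) (hτ' : IsTraceClass τ)
    (hσ : 0 ≤ σ) (hσ' : IsTraceClass σ) {lam : ℝ≥0} (h : τ ≤ ((lam : ℝ) : ℂ) • σ) :
    (trace (M ∘L τ)).re ≤ lam * (trace (M ∘L σ)).re := by
  rw [trace_comp_eq hM hτ hτ', trace_comp_eq hM hσ hσ', Complex.ofReal_re, Complex.ofReal_re]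
  have hfin : hsSq (posSqrt σ ∘L posSqrt M) ≠ ⊤ :=
    hsSq_comp_ne_top' (hsSq_posSqrt_ne_top hσ hσ') _
  have := ENNReal.toReal_mono (ENNReal.mul_ne_top ENNReal.coe_ne_top hfin)
    (hsSq_posSqrt_comp_le (T := posSqrt M) hτ hσ h)
  rwa [ENNReal.toReal_mul, ENNReal.coe_toReal] at this

/-- The operator `∑ₖ wₖ |vₖ⟩⟨vₖ|`. -/
def weightedSum {n : ℕ} (w : Fin n → ℝ) (v : Fin n → H) : H →L[ℂ] H :=
  ∑ k, ((w k : ℝ) : ℂ) • InnerProductSpace.rankOne ℂ (v k) (v k)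

theorem weightedSum_nonneg {n : ℕ} {w : Fin n → ℝ} (hw : ∀ k, 0 ≤ w k) (v : Fin n → H) :
    0 ≤ weightedSum w v := by
  rw [ContinuousLinearMap.nonneg_iff_isPositive]
  refine ContinuousLinearMap.isPositive_sum _ fun k _ => ?_
  exact (InnerProductSpace.isPositive_rankOne_self (v k)).smul_of_nonneg
    (Complex.zero_le_real.2 (hw k))

theorem isCompactOperator_weightedSum {n : ℕ} (w : Fin n → ℝ) (v : Fin n → H) :
    IsCompactOperator (weightedSum w v) := by
  have h : ∀ s : Finset (Fin n), IsCompactOperator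
      (∑ k ∈ s, ((w k : ℝ) : ℂ) • InnerProductSpace.rankOne ℂ (v k) (v k) : H →L[ℂ] H) := by
    intro s
    classical
    induction s using Finset.induction_on with
    | empty => simpa using isCompactOperator_zero
    | insert k s hk ih =>
      rw [Finset.sum_insert hk]
      refine IsCompactOperator.add (IsCompactOperator.smul ?_ _) ih
      rw [InnerProductSpace.rankOne_def']
      have hf : IsCompactOperator (innerSL ℂ (v k)) :=
        isCompactOperator_of_locallyCompactSpace_dom (innerSL ℂ (v k))
      exact hf.clm_comp (ContinuousLinearMap.toSpanSingleton ℂ (v k))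
  exact h _

/-- The inner-product expansion for `T* v` and `v`, so boundedness of `T` is enough. -/
theorem hasSum_trace_rankOne (v : H) (T : H →L[ℂ] H) :
    HasSum (fun i => ⟪basis H i, (InnerProductSpace.rankOne ℂ v v ∘L T) (basis H i)⟫_ℂ)
      ⟪v, T v⟫_ℂ := by
  have h := (basis H).hasSum_inner_mul_inner (adjoint T v) v
  rw [ContinuousLinearMap.adjoint_inner_left] at h
  refine h.congr_fun fun i => ?_
  rw [ContinuousLinearMap.comp_apply, InnerProductSpace.rankOne_apply, inner_smul_right,
    ContinuousLinearMap.adjoint_inner_left]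

theorem trace_weightedSum_comp {n : ℕ} (w : Fin n → ℝ) (v : Fin n → H) (T : H →L[ℂ] H) :
    trace (weightedSum w v ∘L T) = ∑ k, (w k : ℂ) * ⟪v k, T (v k)⟫_ℂ := by
  refine HasSum.tsum_eq ?_
  refine (hasSum_sum (s := Finset.univ) fun k _ =>
    (hasSum_trace_rankOne (v k) T).mul_left (w k : ℂ)).congr_fun fun i => ?_
  simp [weightedSum]

end Duality

/-! ### Weak and strong duality. -/

section Main

open ContinuousLinearMap (adjoint)

variable {H : Type*} [NormedAddCommGroup H] [InnerProductSpace ℂ H] [CompleteSpace H]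

/-- Weak duality. -/
theorem dual_le_primal {ε : ℝ} {ρ σ : H →L[ℂ] H} (hσ : 0 ≤ σ) (hσ' : IsTraceClass σ) :
    (⨆ (M : H →L[ℂ] H) (_ : 0 ≤ M ∧ IsCompactOperator M ∧ (trace (M ∘L σ)).re ≤ 1),
      ⨅ (τ : H →L[ℂ] H) (_ : IsSubstate τ ∧ sineDistance τ ρ ≤ ε),
        ENNReal.ofReal (trace (M ∘L τ)).re) ≤
    ⨅ (τ : H →L[ℂ] H) (_ : IsSubstate τ ∧ sineDistance τ ρ ≤ ε),
      ⨅ (lam : ℝ≥0) (_ : τ ≤ ((lam : ℝ) : ℂ) • σ), (lam : ℝ≥0∞) := by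
  refine iSup₂_le fun M hM => le_iInf₂ fun τ hτ => le_iInf₂ fun lam hlam => ?_
  refine (iInf₂_le τ hτ).trans ?_
  rw [← ENNReal.ofReal_coe_nnreal]
  refine ENNReal.ofReal_le_ofReal ?_
  calc (trace (M ∘L τ)).re ≤ lam * (trace (M ∘L σ)).re :=
        re_trace_comp_le hM.1 hτ.1.1 hτ.1.2.1 hσ hσ' hlam
    _ ≤ lam * 1 := by gcongr; exact hM.2.2
    _ = lam := mul_one _

/-- If every dual feasible operator has value below `lam`, then non-negative combinations of rank
one constraints can be nearly satisfied on the smoothing ball. -/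
theorem exists_sum_inner_lt {ε : ℝ} {ρ σ : H →L[ℂ] H} (hσ : 0 ≤ σ) {lam : ℝ} (hlam : 0 < lam)
    (h : ∀ M : H →L[ℂ] H, 0 ≤ M ∧ IsCompactOperator M ∧ (trace (M ∘L σ)).re ≤ 1 →
      ∃ τ : H →L[ℂ] H, (IsSubstate τ ∧ sineDistance τ ρ ≤ ε) ∧ (trace (M ∘L τ)).re < lam)
    {n : ℕ} {w : Fin n → ℝ} (hw : ∀ k, 0 ≤ w k) (v : Fin n → H) {δ : ℝ} (hδ : 0 < δ) :
    ∃ τ : H →L[ℂ] H, (IsSubstate τ ∧ sineDistance τ ρ ≤ ε) ∧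
      ∑ k, w k * (⟪v k, τ (v k)⟫_ℂ).re <
        ∑ k, w k * (lam * (⟪v k, σ (v k)⟫_ℂ).re) + δ := by
  have htr : ∀ (u : Fin n → ℝ) (T : H →L[ℂ] H), (trace (weightedSum u v ∘L T)).re =
      ∑ k, u k * (⟪v k, T (v k)⟫_ℂ).re := fun u T => by
    rw [trace_weightedSum_comp, Complex.re_sum]
    simp
  set m := ∑ k, w k * (⟪v k, σ (v k)⟫_ℂ).re with hm
  have hm0 : 0 ≤ m := Finset.sum_nonneg fun k _ => mul_nonneg (hw k) (by
    rw [inner_apply_eq_norm_posSqrt_sq hσ, Complex.ofReal_re]; positivity)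
  -- Dividing the weights by `s` gives `Tr[Mσ] = m / s ≤ 1`. The extra `δ / lam` keeps `s` positive
  -- when `m = 0` and becomes the slack `δ` after multiplication by `lam`.
  set s := m + δ / lam with hs
  have hs0 : 0 < s := by positivity
  have hscale : ∀ T : H →L[ℂ] H, (trace (weightedSum (fun k => w k / s) v ∘L T)).re =
      (∑ k, w k * (⟪v k, T (v k)⟫_ℂ).re) / s := fun T => by
    rw [htr, Finset.sum_div]
    exact Finset.sum_congr rfl fun k _ => by ring
  obtain ⟨τ, hτ, hlt⟩ := h (weightedSum (fun k => w k / s) v)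
    ⟨weightedSum_nonneg (fun k => div_nonneg (hw k) hs0.le) v, isCompactOperator_weightedSum _ v, by
      rw [hscale, div_le_one hs0, ← hm, hs]
      exact le_add_of_nonneg_right (by positivity)⟩
  refine ⟨τ, hτ, ?_⟩
  rw [hscale, div_lt_iff₀ hs0, hs, mul_add, mul_div_cancel₀ _ hlam.ne', hm, Finset.mul_sum] at hlt
  refine hlt.trans_eq ?_
  congr 1
  exact Finset.sum_congr rfl fun k _ => by ring

/-- Strong duality. -/
theorem exists_le_smul_of_forall_dual_lt [TopologicalSpace.SeparableSpace H] {ε : ℝ}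
    (hε : ε ∈ Set.Ioo (0 : ℝ) 1) {ρ σ : H →L[ℂ] H} (hρ : IsState ρ) (hσ : 0 ≤ σ) {lam : ℝ}
    (hlam : 0 < lam)
    (h : ∀ M : H →L[ℂ] H, 0 ≤ M ∧ IsCompactOperator M ∧ (trace (M ∘L σ)).re ≤ 1 →
      ∃ τ : H →L[ℂ] H, (IsSubstate τ ∧ sineDistance τ ρ ≤ ε) ∧ (trace (M ∘L τ)).re < lam) :
    ∃ τ : H →L[ℂ] H, (IsSubstate τ ∧ sineDistance τ ρ ≤ ε) ∧ τ ≤ (lam : ℂ) • σ := by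
  set v := TopologicalSpace.denseSeq H with hv
  obtain ⟨r, hr⟩ := exists_family (hsSq_posSqrt_ne_top hρ.1 hρ.2.1)
  obtain ⟨a, ⟨ha, hac⟩, hak⟩ := exists_forall_norm_sq_le
    (fun k => (ContinuousLinearMap.apply ℂ H (v k)).comp (analysis (H := H)))
    (fun k => lam * (⟪v k, σ (v k)⟫_ℂ).re) r (Real.sqrt (1 - ε ^ 2)) (by
      intro n w hw δ hδ
      obtain ⟨τ, hτ, hlt⟩ := exists_sum_inner_lt hσ hlam h hw (fun k => v k) hδ
      obtain ⟨A, hA1, hA2, hA3⟩ := exists_hilbertSchmidt_of_sineDistance_le hτ.1 hρ hε hτ.2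
      obtain ⟨a, ha⟩ := exists_family (ne_top_of_le_ne_top ENNReal.one_ne_top hA1)
      refine ⟨a, ⟨(hsSq_le_one_iff ha).1 hA1, by rwa [inner_eq_hsInner ha hr]⟩, ?_⟩
      refine lt_of_le_of_lt (Finset.sum_le_sum fun k _ => ?_) hlt
      refine mul_le_mul_of_nonneg_left ?_ (hw k)
      change ‖analysis a (v k)‖ ^ 2 ≤ _
      rw [analysis_eq_adjoint ha]
      exact hA2 _)
  set A := adjoint (analysis a) with hA
  have haA : ∀ i, a i = A (basis H i) := fun i => (adjoint_analysis_basis a i).symm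
  have hA1 : hsSq A ≤ 1 := (hsSq_le_one_iff haA).2 ha
  have hτ := isSubstate_comp_adjoint hA1
  refine ⟨A ∘L adjoint A, ⟨hτ, sineDistance_comp_adjoint_le hA1 hρ hε
    (by rwa [← inner_eq_hsInner haA hr])⟩, ?_⟩
  have hsa : IsSelfAdjoint ((lam : ℂ) • σ) :=
    (((ContinuousLinearMap.nonneg_iff_isPositive _).1 hσ).smul_of_nonneg
      (Complex.zero_le_real.2 hlam.le)).isSelfAdjoint
  rw [le_iff_re_inner (IsSelfAdjoint.of_nonneg hτ.1) hsa]
  have hL : ∀ x, (⟪x, (A ∘L adjoint A) x⟫_ℂ).re = ‖analysis a x‖ ^ 2 := fun x => by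
    rw [ContinuousLinearMap.comp_apply, ← ContinuousLinearMap.adjoint_inner_left,
      inner_self_eq_norm_sq_to_K, hA, ContinuousLinearMap.adjoint_adjoint]
    norm_cast
  have hR : ∀ x, (⟪x, ((lam : ℂ) • σ) x⟫_ℂ).re = lam * (⟪x, σ x⟫_ℂ).re := fun x => by
    rw [smul_apply, inner_smul_right, Complex.re_ofReal_mul]
  intro x
  rw [hL, hR]
  -- Both quadratic forms are continuous, so the inequality passes from the dense sequence to all of
  -- `H`.
  have hcl : IsClosed {x : H | ‖analysis a x‖ ^ 2 ≤ lam * (⟪x, σ x⟫_ℂ).re} :=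
    isClosed_le (by fun_prop) (continuous_const.mul (Complex.continuous_re.comp
      (continuous_id.inner σ.continuous)))
  refine hcl.closure_subset_iff.2 ?_ (TopologicalSpace.denseRange_denseSeq H x)
  rintro _ ⟨k, rfl⟩
  exact hak k

/-- The primal value equals the dual value. -/
theorem primal_eq_dual [TopologicalSpace.SeparableSpace H] {ε : ℝ}
    (hε : ε ∈ Set.Ioo (0 : ℝ) 1) {ρ σ : H →L[ℂ] H} (hρ : IsState ρ) (hσ : 0 ≤ σ)
    (hσ' : IsTraceClass σ) :
    (⨅ (τ : H →L[ℂ] H) (_ : IsSubstate τ ∧ sineDistance τ ρ ≤ ε),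
      ⨅ (lam : ℝ≥0) (_ : τ ≤ ((lam : ℝ) : ℂ) • σ), (lam : ℝ≥0∞)) =
    ⨆ (M : H →L[ℂ] H) (_ : 0 ≤ M ∧ IsCompactOperator M ∧ (trace (M ∘L σ)).re ≤ 1),
      ⨅ (τ : H →L[ℂ] H) (_ : IsSubstate τ ∧ sineDistance τ ρ ≤ ε),
        ENNReal.ofReal (trace (M ∘L τ)).re := by
  refine le_antisymm ?_ (dual_le_primal hσ hσ')
  by_contra hlt
  -- A number strictly inside the supposed gap: lying above the dual value, it is positive and
  -- strong duality makes it primal feasible, contradicting `hp`.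
  obtain ⟨lam, hd, hp⟩ := ENNReal.lt_iff_exists_nnreal_btwn.1 (not_le.1 hlt)
  have hlam : 0 < lam := ENNReal.coe_pos.1 (zero_le.trans_lt hd)
  obtain ⟨τ, hτ, hle⟩ := exists_le_smul_of_forall_dual_lt (lam := (lam : ℝ)) hε hρ hσ
    (NNReal.coe_pos.2 hlam) (fun M hM => by
      have h1 := (le_iSup₂ (f := fun (M : H →L[ℂ] H)
        (_ : 0 ≤ M ∧ IsCompactOperator M ∧ (trace (M ∘L σ)).re ≤ 1) =>
        ⨅ (τ : H →L[ℂ] H) (_ : IsSubstate τ ∧ sineDistance τ ρ ≤ ε),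
        ENNReal.ofReal (trace (M ∘L τ)).re) M hM).trans_lt hd
      simp only [iInf_lt_iff] at h1
      obtain ⟨τ, hτ, h2⟩ := h1
      rw [← ENNReal.ofReal_coe_nnreal, ENNReal.ofReal_lt_ofReal_iff (NNReal.coe_pos.2 hlam)] at h2
      exact ⟨τ, hτ, h2⟩)
  exact absurd ((iInf₂_le τ hτ).trans (iInf₂_le lam hle)) (not_le.2 hp)

end Main

end QInfo

end

theorem mainTheorem7 {H : Type*} [NormedAddCommGroup H] [InnerProductSpace ℂ H] [CompleteSpace H]
    [TopologicalSpace.SeparableSpace H]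
    (ρ σ : H →L[ℂ] H) (hρ : QInfo.IsState ρ) (hσ : 0 ≤ σ) (hσ' : QInfo.IsTraceClass σ)
    (ε : ℝ) (hε : ε ∈ Set.Ioo (0 : ℝ) 1) (hfin : QInfo.smoothDmax ε ρ σ < ⊤) :
    QInfo.smoothDmax ε ρ σ = QInfo.dualSmoothDmax ε ρ σ := by
  unfold QInfo.smoothDmax QInfo.dualSmoothDmax
  rw [QInfo.primal_eq_dual hε hρ hσ hσ']
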